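/- Let $\mathcal U\subset\mathbb R^d$ ($d\ge1$) be a connected bounded Lipschitz domain with outward unit normal $\tilde n$, let $f\in L^2(\mathcal U)$, $\tilde g\in H^{1/2}(\partial\mathcal U)$ and $\alpha\ge0$, and let $u\in H^1(\mathcal U)$ be the solution of $$-\Delta u+u=f\ \text{ in }\mathcal U,\qquad \frac{\partial u}{\partial\tilde n}+\alpha u=\tilde g\ \text{ on }\partial\mathcal U,$$ understood in the weak sense: for all $v\in H^1(\mathcal U)$, $$\int_{\mathcal U}\nabla u\cdot\nabla v+\int_{\mathcal U}uv+\alpha\int_{\partial\mathcal U}uv=\int_{\mathcal U}fv+\int_{\partial\mathcal U}\tilde g v,$$ where the values on $\partial\mathcal U$ are traces and the boundary integrals are taken with respect to surface measure. (i) If $f\ge0$ a.e. in $\mathcal U$ and $\tilde g\ge0$ a.e. on $\partial\mathcal U$, then $u\ge0$ a.e. in $\mathcal U$. (ii) If $c>0$ is a constant such that $f\ge c$ a.e. in $\mathcal U$ and $\tilde g\ge\alpha c$ a.e. on $\partial\mathcal U$, then $u\ge c$ a.e. in $\mathcal U$. -/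

import Mathlib

open MeasureTheory Filter Topology
open scoped ContDiff

noncomputable section

/-- A Lipschitz open set, locally on one side of its boundary: near each boundary point `x₀` there
are a unit vector `e` and a Lipschitz function `γ` of the component orthogonal to `e`
such that the set is locally `{y | γ(y - ⟪e, y⟫ e) < ⟪e, y⟫}`. -/
def HasLipschitzBoundary {d : ℕ} (U : Set (EuclideanSpace ℝ (Fin d))) : Prop :=
  ∀ x₀ ∈ frontier U, ∃ (e : EuclideanSpace ℝ (Fin d)) (γ : EuclideanSpace ℝ (Fin d) → ℝ)
    (K : NNReal) (r : ℝ), ‖e‖ = 1 ∧ LipschitzWith K γ ∧ 0 < r ∧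
      ∀ y ∈ Metric.ball x₀ r, y ∈ U ↔ γ (y - inner ℝ e y • e) < inner ℝ e y

/-- Connected bounded Lipschitz domains (nonempty, by `IsConnected`). -/
structure IsBoundedLipschitzDomain {d : ℕ} (U : Set (EuclideanSpace ℝ (Fin d))) : Prop where
  isOpen : IsOpen U
  isConnected : IsConnected U
  isBounded : Bornology.IsBounded U
  lipschitz : HasLipschitzBoundary U

/-- Lebesgue measure on `U`. -/
abbrev interiorMeasure {d : ℕ} (U : Set (EuclideanSpace ℝ (Fin d))) :
    Measure (EuclideanSpace ℝ (Fin d)) :=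
  volume.restrict U

/-- Surface measure on `∂U`: the `(d-1)`-dimensional Hausdorff measure, normalized so that on
`(d-1)`-dimensional Euclidean spaces it is Lebesgue measure. -/
abbrev surfaceMeasure {d : ℕ} (U : Set (EuclideanSpace ℝ (Fin d))) :
    Measure (EuclideanSpace ℝ (Fin d)) :=
  (Measure.euclideanHausdorffMeasure (d - 1)).restrict (frontier U)

/-- `u ∈ H¹(U)`, with weak gradient `Du`: both are in `L²(U)`, and
`∫_U u ∂ₑφ = - ∫_U ⟪Du, e⟫ φ` for all `φ ∈ C_c^∞(U)` and all directions `e`. -/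
structure IsH1WithGradient {d : ℕ} (U : Set (EuclideanSpace ℝ (Fin d)))
    (u : EuclideanSpace ℝ (Fin d) → ℝ)
    (Du : EuclideanSpace ℝ (Fin d) → EuclideanSpace ℝ (Fin d)) : Prop where
  memLp : MemLp u 2 (interiorMeasure U)
  memLp_gradient : MemLp Du 2 (interiorMeasure U)
  integral_eq : ∀ φ : EuclideanSpace ℝ (Fin d) → ℝ, ContDiff ℝ ∞ φ → HasCompactSupport φ →
    tsupport φ ⊆ U → ∀ e : EuclideanSpace ℝ (Fin d),
      ∫ x in U, u x * fderiv ℝ φ x e = - ∫ x in U, inner ℝ (Du x) e * φ x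

/-- `τ` is the trace on `∂U` of the function `u ∈ H¹(U)` with weak gradient `Du`. The trace
operator is the closure of the restriction `φ ↦ φ|_∂U` of smooth functions: some `φₙ`, smooth
up to the boundary, tend to `u` in `H¹(U)` while their boundary values tend to `τ` in `L²(∂U)`. -/
structure HasTrace {d : ℕ} (U : Set (EuclideanSpace ℝ (Fin d)))
    (u : EuclideanSpace ℝ (Fin d) → ℝ)
    (Du : EuclideanSpace ℝ (Fin d) → EuclideanSpace ℝ (Fin d))
    (τ : EuclideanSpace ℝ (Fin d) → ℝ) : Prop where
  isH1 : IsH1WithGradient U u Du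
  memLp_trace : MemLp τ 2 (surfaceMeasure U)
  exists_approx : ∃ φ : ℕ → EuclideanSpace ℝ (Fin d) → ℝ, (∀ n, ContDiff ℝ ∞ (φ n)) ∧
    Tendsto (fun n ↦ eLpNorm (fun x ↦ φ n x - u x) 2 (interiorMeasure U)) atTop (𝓝 0) ∧
    Tendsto (fun n ↦ eLpNorm (fun x ↦ gradient (φ n) x - Du x) 2 (interiorMeasure U))
      atTop (𝓝 0) ∧
    Tendsto (fun n ↦ eLpNorm (fun x ↦ φ n x - τ x) 2 (surfaceMeasure U)) atTop (𝓝 0)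

/-- `g ∈ H^{1/2}(∂U)`: `g ∈ L²(∂U)` with finite Gagliardo–Slobodeckij seminorm
`∫∫ |g(x) - g(y)|² / |x - y|^d dσ(x) dσ(y)`, the exponent being `(d - 1) + 2 · (1/2) = d`. -/
structure MemHHalfBoundary {d : ℕ} (U : Set (EuclideanSpace ℝ (Fin d)))
    (g : EuclideanSpace ℝ (Fin d) → ℝ) : Prop where
  memLp : MemLp g 2 (surfaceMeasure U)
  seminorm_lt_top :
    ∫⁻ x, ∫⁻ y, ENNReal.ofReal ((g x - g y) ^ 2 / dist x y ^ d)
      ∂(surfaceMeasure U) ∂(surfaceMeasure U) < ⊤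

/-- `u ∈ H¹(U)` is a (weak) solution of `-Δu + u = f` in `U`, `∂u/∂n + α u = g` on `∂U`:
for all `v ∈ H¹(U)`,
`∫_U ∇u·∇v + ∫_U u v + α ∫_∂U u v = ∫_U f v + ∫_∂U g v`, with boundary values taken as traces. -/
def IsRobinSolution {d : ℕ} (U : Set (EuclideanSpace ℝ (Fin d))) (α : ℝ)
    (f g u : EuclideanSpace ℝ (Fin d) → ℝ) : Prop :=
  ∃ (Du : EuclideanSpace ℝ (Fin d) → EuclideanSpace ℝ (Fin d))
    (τu : EuclideanSpace ℝ (Fin d) → ℝ), HasTrace U u Du τu ∧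
    ∀ (v : EuclideanSpace ℝ (Fin d) → ℝ)
      (Dv : EuclideanSpace ℝ (Fin d) → EuclideanSpace ℝ (Fin d))
      (τv : EuclideanSpace ℝ (Fin d) → ℝ), HasTrace U v Dv τv →
      (∫ x, inner ℝ (Du x) (Dv x) ∂(interiorMeasure U)) + (∫ x, u x * v x ∂(interiorMeasure U))
          + α * (∫ x, τu x * τv x ∂(surfaceMeasure U))
        = (∫ x, f x * v x ∂(interiorMeasure U)) + ∫ x, g x * τv x ∂(surfaceMeasure U)

end

/-! Stampacchia truncation. Both claims are one comparison with the constant `c` (`c = 0` gives the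
first), proved in `IsRobinSolution.const_le`. Let `G` be smooth, Lipschitz and nondecreasing, zero
on `[c, ∞)` and negative below `c`. Testing with `v = G(u)` and subtracting the contributions of `c`
gives `∫ G'(u)|∇u|² + ∫ (u - c) G(u) + α ∫ (τ - c) G(τ) = ∫ (f - c) G(u) + ∫ (g - αc) G(τ)`. Each
term on the left is nonnegative and the right side is nonpositive, so `(u - c) G(u) = 0` a.e., that
is `u ≥ c`.

The work lies in the admissibility of `v`, which is `HasTrace.comp`. As `G` is smooth, it maps
smooth approximants of `u` to smooth approximants of `G(u)`, so no chain rule for positive parts is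
needed. Constants must be in `L²(∂U)`, hence the finiteness of the surface measure. -/

/-! ### Finiteness of the surface measure. -/

/-- Over the ball where `U` is the epigraph of `γ`, the boundary of `U` is on the graph of `γ`. -/
lemma eq_inner_of_mem_frontier {d : ℕ} {U : Set (EuclideanSpace ℝ (Fin d))} (hU : IsOpen U)
    {x₀ e : EuclideanSpace ℝ (Fin d)} {γ : EuclideanSpace ℝ (Fin d) → ℝ} {r : ℝ}
    (hγ : Continuous γ)
    (h : ∀ y ∈ Metric.ball x₀ r, y ∈ U ↔ γ (y - inner ℝ e y • e) < inner ℝ e y)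
    {y : EuclideanSpace ℝ (Fin d)} (hy : y ∈ frontier U) (hyr : y ∈ Metric.ball x₀ r) :
    γ (y - inner ℝ e y • e) = inner ℝ e y := by
  have hyU : y ∉ U := fun hyU ↦ (hU.frontier_eq ▸ hy).2 hyU
  refine le_antisymm (not_lt.1 fun hlt ↦ ?_) (not_lt.1 fun hlt ↦ hyU ((h y hyr).2 hlt))
  -- Strictly below the graph there is a neighbourhood of `y` that misses `U`, contrary to `y ∈
  -- closure U`.
  have hopen : IsOpen {z : EuclideanSpace ℝ (Fin d) | inner ℝ e z < γ (z - inner ℝ e z • e)} :=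
    isOpen_lt (by fun_prop) (by fun_prop)
  obtain ⟨z, ⟨hz, hzr⟩, hzU⟩ := mem_closure_iff.1 (frontier_subset_closure hy) _
    (hopen.inter Metric.isOpen_ball) ⟨hlt, hyr⟩
  exact lt_asymm hz ((h z hzr).1 hzU)

/-- The normalizing factor depends only on `n`, so it is the same on both sides of the Hausdorff
estimate with constant `K ^ n`. -/
lemma LipschitzWith.euclideanHausdorffMeasure_image_lt_top {X Y : Type*}
    [MetricSpace X] [MeasurableSpace X] [BorelSpace X]
    [MetricSpace Y] [MeasurableSpace Y] [BorelSpace Y] {K : NNReal} {F : X → Y}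
    (hF : LipschitzWith K F) {n : ℕ} {s : Set X}
    (hs : Measure.euclideanHausdorffMeasure n s < ⊤) :
    Measure.euclideanHausdorffMeasure n (F '' s) < ⊤ := by
  have hle : Measure.euclideanHausdorffMeasure n (F '' s)
      ≤ (K : ENNReal) ^ (n : ℝ) * Measure.euclideanHausdorffMeasure n s := by
    simp only [Measure.euclideanHausdorffMeasure_def, Measure.smul_apply, ENNReal.smul_def,
      smul_eq_mul]
    rw [mul_left_comm]
    gcongr
    exact hF.hausdorffMeasure_image_le n.cast_nonneg s
  refine hle.trans_lt (ENNReal.mul_lt_top ?_ hs)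
  exact ENNReal.rpow_lt_top_of_nonneg n.cast_nonneg ENNReal.coe_ne_top

/-- The boundary of a bounded Lipschitz domain has finite surface measure. -/
lemma isFiniteMeasure_surfaceMeasure {d : ℕ} (hd : 1 ≤ d) {U : Set (EuclideanSpace ℝ (Fin d))}
    (hU : IsBoundedLipschitzDomain U) : IsFiniteMeasure (surfaceMeasure U) := by
  have hcomp : IsCompact (frontier U) :=
    Metric.isCompact_of_isClosed_isBounded isClosed_frontier
      (hU.isBounded.closure.subset frontier_subset_closure)
  refine isFiniteMeasure_restrict.2 (ne_of_lt ?_)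
  refine hcomp.measure_lt_top_of_nhdsWithin fun x₀ hx₀ ↦ ?_
  obtain ⟨e, γ, K, r, he, hγ, hr, h⟩ := hU.lipschitz x₀ hx₀
  refine ⟨Metric.ball x₀ r ∩ frontier U,
    Filter.inter_mem (mem_nhdsWithin_of_mem_nhds (Metric.ball_mem_nhds x₀ hr)) self_mem_nhdsWithin,
    ?_⟩
  let H : Submodule ℝ (EuclideanSpace ℝ (Fin d)) := (Submodule.span ℝ {e})ᗮ
  have hfin : Module.finrank ℝ H = d - 1 := by
    have : Fact (Module.finrank ℝ (EuclideanSpace ℝ (Fin d)) = (d - 1) + 1) :=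
      ⟨by simp; omega⟩
    exact Submodule.finrank_orthogonal_span_singleton (by rintro rfl; simp at he)
  -- The graph map over the hyperplane `eᗮ`: the local piece of boundary lies in the Lipschitz image
  -- of a ball of dimension `d - 1`.
  let F : H → EuclideanSpace ℝ (Fin d) := fun z ↦ z + γ z • e
  have hF : LipschitzWith (1 + K) F := by
    refine LipschitzWith.add (LipschitzWith.subtype_val _) (LipschitzWith.of_dist_le_mul fun z w ↦ ?_)
    rw [dist_eq_norm, ← sub_smul, norm_smul, he, mul_one, ← dist_eq_norm]
    exact hγ.dist_le_mul z w
  have hball : Measure.euclideanHausdorffMeasure (d - 1)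
      (Metric.closedBall (0 : H) (‖x₀‖ + r)) < ⊤ := by
    rw [← hfin]
    exact (isCompact_closedBall _ _).measure_lt_top
  refine (measure_mono ?_).trans_lt (hF.euclideanHausdorffMeasure_image_lt_top hball)
  rintro y ⟨hyr, hy⟩
  have hmem : y - inner ℝ e y • e ∈ H := by
    rw [Submodule.mem_orthogonal_singleton_iff_inner_right, inner_sub_right, inner_smul_right,
      real_inner_self_eq_norm_sq, he]
    ring
  refine ⟨⟨_, hmem⟩, ?_, ?_⟩
  · have hpyth : ‖y - inner ℝ e y • e‖ ^ 2 = ‖y‖ ^ 2 - inner ℝ e y ^ 2 := by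
      rw [norm_sub_sq_real, inner_smul_right, norm_smul, he, real_inner_comm, mul_one,
        Real.norm_eq_abs, sq_abs]
      ring
    have hle : ‖y - inner ℝ e y • e‖ ≤ ‖y‖ :=
      le_of_sq_le_sq (by rw [hpyth]; linarith [sq_nonneg (inner ℝ e y)]) (norm_nonneg y)
    have hyle : ‖y‖ ≤ ‖x₀‖ + r := by
      have := norm_le_norm_add_norm_sub' y x₀
      rw [← dist_eq_norm] at this
      linarith [Metric.mem_ball.1 hyr]
    simpa using hle.trans hyle
  · change y - inner ℝ e y • e + γ (y - inner ℝ e y • e) • e = y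
    rw [eq_inner_of_mem_frontier hU.isOpen hγ.continuous h hy hyr, sub_add_cancel]

/-! ### Convergence in `L²` under composition and multiplication. -/

section Nemytskii

variable {X E : Type*} [MeasurableSpace X] {μ : Measure X} [NormedAddCommGroup E]
  {K : NNReal} {G : ℝ → ℝ}

lemma LipschitzWith.comp_memLp_of_isFiniteMeasure [IsFiniteMeasure μ] (hG : LipschitzWith K G)
    {p : ENNReal} {u : X → ℝ} (hu : MemLp u p μ) : MemLp (fun x ↦ G (u x)) p μ := by
  -- `G 0` need not vanish; the constant is put back using that `μ` is finite.
  have h0 : LipschitzWith K fun t ↦ G t - G 0 := by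
    refine LipschitzWith.of_dist_le_mul fun s t ↦ ?_
    rw [dist_sub_right]
    exact hG.dist_le_mul s t
  have h1 : MemLp (fun x ↦ G (u x) - G 0) p μ := h0.comp_memLp (sub_self _) hu
  simpa [Pi.add_def] using h1.add (memLp_const (G 0))

lemma LipschitzWith.tendsto_eLpNorm_comp_sub (hG : LipschitzWith K G) {p : ENNReal}
    {φ : ℕ → X → ℝ} {u : X → ℝ}
    (h : Tendsto (fun n ↦ eLpNorm (fun x ↦ φ n x - u x) p μ) atTop (𝓝 0)) :
    Tendsto (fun n ↦ eLpNorm (fun x ↦ G (φ n x) - G (u x)) p μ) atTop (𝓝 0) := by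
  have hK : Tendsto (fun n ↦ (K : ENNReal) * eLpNorm (fun x ↦ φ n x - u x) p μ) atTop (𝓝 0) := by
    simpa using ENNReal.Tendsto.const_mul h (Or.inr ENNReal.coe_ne_top)
  refine tendsto_of_tendsto_of_tendsto_of_le_of_le tendsto_const_nhds hK (fun _ ↦ zero_le)
    fun n ↦ ?_
  refine eLpNorm_le_nnreal_smul_eLpNorm_of_ae_le_mul (.of_forall fun x ↦ ?_) p
  rw [← NNReal.coe_le_coe]
  simpa [dist_eq_norm] using hG.dist_le_mul (φ n x) (u x)

/-- Bounded factors that converge almost everywhere converge strongly as multipliers on `L²`. -/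
lemma tendsto_eLpNorm_two_sub_smul [NormedSpace ℝ E] {a : ℕ → X → ℝ} {b : X → ℝ} {D : X → E}
    (ha : ∀ n, AEStronglyMeasurable (a n) μ) (hb : AEStronglyMeasurable b μ)
    (haK : ∀ n x, ‖a n x‖ ≤ K) (hbK : ∀ x, ‖b x‖ ≤ K) (hD : MemLp D 2 μ)
    (hlim : ∀ᵐ x ∂μ, Tendsto (fun n ↦ a n x) atTop (𝓝 (b x))) :
    Tendsto (fun n ↦ eLpNorm (fun x ↦ (a n x - b x) • D x) 2 μ) atTop (𝓝 0) := by
  have hfin : ∫⁻ x, (‖(2 * (K : ℝ)) • D x‖ₑ) ^ (2 : ℝ) ∂μ ≠ ⊤ := by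
    have := (hD.const_smul (2 * (K : ℝ))).eLpNorm_lt_top
    have := lintegral_rpow_enorm_lt_top_of_eLpNorm_lt_top (by norm_num) (by norm_num) this
    simpa using this.ne
  have hlint : Tendsto (fun n ↦ ∫⁻ x, ‖(a n x - b x) • D x‖ₑ ^ (2 : ℝ) ∂μ) atTop
      (𝓝 (∫⁻ _, 0 ∂μ)) := by
    refine tendsto_lintegral_of_dominated_convergence' _
      (fun n ↦ ((((ha n).sub hb).smul hD.1).enorm.pow_const _)) (fun n ↦ .of_forall fun x ↦ ?_)
      hfin ?_
    · refine ENNReal.rpow_le_rpow ?_ (by norm_num)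
      rw [enorm_le_iff_norm_le, norm_smul, norm_smul]
      refine mul_le_mul_of_nonneg_right ((norm_sub_le _ _).trans ?_) (norm_nonneg _)
      linarith [haK n x, hbK x, Real.le_norm_self (2 * (K : ℝ))]
    · filter_upwards [hlim] with x hx
      have h0 : Tendsto (fun n ↦ (a n x - b x) • D x) atTop (𝓝 0) := by
        simpa using (hx.sub_const (b x)).smul_const (D x)
      have := (ENNReal.continuous_rpow_const (y := 2)).tendsto _ |>.comp h0.enorm
      simpa [Function.comp_def] using this
  have := (ENNReal.continuous_rpow_const (y := 1 / 2)).tendsto _ |>.comp hlint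
  simpa [Function.comp_def, eLpNorm_eq_lintegral_rpow_enorm_toReal] using this

/-- Pairing with a fixed function in `L²` is continuous for convergence in `L²`. -/
lemma tendsto_integral_mul_of_tendsto_eLpNorm_two {a : ℕ → X → ℝ} {a₀ b : X → ℝ}
    (han : ∀ n, MemLp (a n) 2 μ) (ha₀ : MemLp a₀ 2 μ) (hb : MemLp b 2 μ)
    (h : Tendsto (fun n ↦ eLpNorm (fun x ↦ a n x - a₀ x) 2 μ) atTop (𝓝 0)) :
    Tendsto (fun n ↦ ∫ x, a n x * b x ∂μ) atTop (𝓝 (∫ x, a₀ x * b x ∂μ)) := by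
  refine tendsto_integral_of_L1' _ (ha₀.integrable_mul hb).1
    (.of_forall fun n ↦ (han n).integrable_mul hb) ?_
  have hlim : Tendsto (fun n ↦ eLpNorm (fun x ↦ a n x - a₀ x) 2 μ * eLpNorm b 2 μ) atTop (𝓝 0) := by
    simpa using ENNReal.Tendsto.mul_const h (Or.inr hb.eLpNorm_ne_top)
  refine tendsto_of_tendsto_of_tendsto_of_le_of_le tendsto_const_nhds hlim (fun _ ↦ zero_le)
    fun n ↦ ?_
  -- Hölder with `1 = 1/2 + 1/2`.
  have := eLpNorm_smul_le_mul_eLpNorm (p := 2) (q := 2) (r := 1) hb.1 ((han n).sub ha₀).1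
  refine (le_of_eq ?_).trans this
  congr 1
  ext x
  simp [sub_mul]

end Nemytskii

/-! ### The chain rule in `H¹(U)` with traces. -/

lemma contDiff_top_continuous_gradient {F : Type*} [NormedAddCommGroup F] [InnerProductSpace ℝ F]
    [CompleteSpace F] {φ : F → ℝ} (hφ : ContDiff ℝ ∞ φ) : Continuous (gradient φ) :=
  (InnerProductSpace.toDual ℝ F).symm.continuous.comp (hφ.continuous_fderiv (by simp))

lemma gradient_comp_real {F : Type*} [NormedAddCommGroup F] [InnerProductSpace ℝ F]
    [CompleteSpace F] {G : ℝ → ℝ} {φ : F → ℝ} {x : F} (hG : DifferentiableAt ℝ G (φ x))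
    (hφ : DifferentiableAt ℝ φ x) :
    gradient (fun y ↦ G (φ y)) x = deriv G (φ x) • gradient φ x := by
  refine HasGradientAt.gradient (hasGradientAt_iff_hasFDerivAt.2 ?_)
  rw [map_smul, toDual_gradient]
  exact hG.hasDerivAt.comp_hasFDerivAt x hφ.hasFDerivAt

lemma Continuous.memLp_restrict_of_isBounded {d : ℕ} {U : Set (EuclideanSpace ℝ (Fin d))}
    (hU : MeasurableSet U) (hb : Bornology.IsBounded U) {F : Type*} [NormedAddCommGroup F]
    [SecondCountableTopology F] {h : EuclideanSpace ℝ (Fin d) → F} (hh : Continuous h)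
    {p : ENNReal} : MemLp h p (interiorMeasure U) := by
  have : IsFiniteMeasure (interiorMeasure U) := isFiniteMeasure_restrict.2 hb.measure_lt_top.ne
  obtain ⟨C, hC⟩ := hb.isCompact_closure.exists_bound_of_continuousOn hh.continuousOn
  refine MemLp.of_bound hh.aestronglyMeasurable C ?_
  filter_upwards [ae_restrict_mem hU] with x hx using hC x (subset_closure hx)

/-- Integration by parts of a smooth function against a test function supported in `U`. -/
lemma setIntegral_mul_fderiv_eq_neg {d : ℕ} {U : Set (EuclideanSpace ℝ (Fin d))}
    {φ ψ : EuclideanSpace ℝ (Fin d) → ℝ} (hφ : ContDiff ℝ ∞ φ) (hψ : ContDiff ℝ ∞ ψ)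
    (hc : HasCompactSupport ψ) (hs : tsupport ψ ⊆ U) (e : EuclideanSpace ℝ (Fin d)) :
    ∫ x in U, φ x * fderiv ℝ ψ x e = - ∫ x in U, inner ℝ (gradient φ x) e * ψ x := by
  have hψ0 : ∀ x ∉ U, ψ x = 0 := fun x hx ↦ image_eq_zero_of_notMem_tsupport fun h ↦ hx (hs h)
  have hψ'0 : ∀ x ∉ U, fderiv ℝ ψ x e = 0 := fun x hx ↦ by
    rw [image_eq_zero_of_notMem_tsupport fun h ↦ hx (hs (tsupport_fderiv_subset ℝ h))]
    rfl
  -- Both integrands vanish off `U`, so the integrals extend to the whole space, where there is no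
  -- boundary term.
  rw [setIntegral_eq_integral_of_forall_compl_eq_zero fun x hx ↦ by rw [hψ'0 x hx, mul_zero],
    setIntegral_eq_integral_of_forall_compl_eq_zero fun x hx ↦ by rw [hψ0 x hx, mul_zero]]
  simp only [inner_gradient_left]
  have hφ' : Continuous fun x ↦ fderiv ℝ φ x e :=
    (hφ.continuous_fderiv (by simp)).clm_apply continuous_const
  have hψ' : Continuous fun x ↦ fderiv ℝ ψ x e :=
    (hψ.continuous_fderiv (by simp)).clm_apply continuous_const
  refine integral_mul_fderiv_eq_neg_fderiv_mul_of_integrable ?_ ?_ ?_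
    (fun x _ ↦ hφ.differentiable (by simp) x) (fun x _ ↦ hψ.differentiable (by simp) x)
  · exact (hφ'.mul hψ.continuous).integrable_of_hasCompactSupport hc.mul_left
  · exact (hφ.continuous.mul hψ').integrable_of_hasCompactSupport (hc.fderiv_apply ℝ e).mul_left
  · exact (hφ.continuous.mul hψ.continuous).integrable_of_hasCompactSupport hc.mul_left

/-- Limits in `H¹(U)` of smooth functions are in `H¹(U)`. -/
lemma IsH1WithGradient.of_tendsto {d : ℕ} {U : Set (EuclideanSpace ℝ (Fin d))}
    (hU : IsOpen U) (hb : Bornology.IsBounded U) {w : EuclideanSpace ℝ (Fin d) → ℝ}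
    {Dw : EuclideanSpace ℝ (Fin d) → EuclideanSpace ℝ (Fin d)}
    {φ : ℕ → EuclideanSpace ℝ (Fin d) → ℝ} (hw : MemLp w 2 (interiorMeasure U))
    (hDw : MemLp Dw 2 (interiorMeasure U)) (hφ : ∀ n, ContDiff ℝ ∞ (φ n))
    (h : Tendsto (fun n ↦ eLpNorm (fun x ↦ φ n x - w x) 2 (interiorMeasure U)) atTop (𝓝 0))
    (h' : Tendsto (fun n ↦ eLpNorm (fun x ↦ gradient (φ n) x - Dw x) 2 (interiorMeasure U))
      atTop (𝓝 0)) : IsH1WithGradient U w Dw := by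
  refine ⟨hw, hDw, fun ψ hψ hc hs e ↦ ?_⟩
  have hψ' : Continuous fun x ↦ fderiv ℝ ψ x e :=
    (hψ.continuous_fderiv (by simp)).clm_apply continuous_const
  have hL := tendsto_integral_mul_of_tendsto_eLpNorm_two
    (fun n ↦ (hφ n).continuous.memLp_restrict_of_isBounded hU.measurableSet hb) hw
    (hψ'.memLp_restrict_of_isBounded hU.measurableSet hb) h
  have he : Tendsto (fun n ↦ eLpNorm (fun x ↦ inner ℝ (gradient (φ n) x) e - inner ℝ (Dw x) e) 2
      (interiorMeasure U)) atTop (𝓝 0) := by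
    have hK : Tendsto (fun n ↦ (‖e‖₊ : ENNReal) *
        eLpNorm (fun x ↦ gradient (φ n) x - Dw x) 2 (interiorMeasure U)) atTop (𝓝 0) := by
      simpa using ENNReal.Tendsto.const_mul h' (Or.inr ENNReal.coe_ne_top)
    refine tendsto_of_tendsto_of_tendsto_of_le_of_le tendsto_const_nhds hK (fun _ ↦ zero_le)
      fun n ↦ eLpNorm_le_nnreal_smul_eLpNorm_of_ae_le_mul (.of_forall fun x ↦ ?_) 2
    rw [← inner_sub_left, mul_comm]
    exact nnnorm_inner_le_nnnorm _ _
  have hR := tendsto_integral_mul_of_tendsto_eLpNorm_two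
    (fun n ↦ ((contDiff_top_continuous_gradient (hφ n)).memLp_restrict_of_isBounded
      hU.measurableSet hb).inner_const e) (hDw.inner_const e)
    (hψ.continuous.memLp_restrict_of_isBounded hU.measurableSet hb) he
  refine tendsto_nhds_unique hL ?_
  simpa only [setIntegral_mul_fderiv_eq_neg (hφ _) hψ hc hs e] using hR.neg

/-- Chain rule in `H¹(U)` with traces, for smooth Lipschitz functions. -/
lemma HasTrace.comp {d : ℕ} {U : Set (EuclideanSpace ℝ (Fin d))}
    (hU : IsOpen U) (hb : Bornology.IsBounded U) [IsFiniteMeasure (surfaceMeasure U)]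
    {u τ : EuclideanSpace ℝ (Fin d) → ℝ}
    {Du : EuclideanSpace ℝ (Fin d) → EuclideanSpace ℝ (Fin d)} (hu : HasTrace U u Du τ)
    {G : ℝ → ℝ} {K : NNReal} (hG : ContDiff ℝ ∞ G) (hL : LipschitzWith K G) :
    HasTrace U (fun x ↦ G (u x)) (fun x ↦ deriv G (u x) • Du x) (fun x ↦ G (τ x)) := by
  have : IsFiniteMeasure (interiorMeasure U) := isFiniteMeasure_restrict.2 hb.measure_lt_top.ne
  have hG' : Continuous (deriv G) := hG.continuous_deriv (by simp)
  have hK : ∀ t, ‖deriv G t‖ ≤ K := fun t ↦ norm_deriv_le_of_lipschitz hL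
  obtain ⟨φ₀, hφ₀, hφ₀u, hφ₀Du, hφ₀τ⟩ := hu.exists_approx
  -- `deriv G` is only known to be continuous and bounded, so `deriv G (φₙ) • Du` is handled by
  -- dominated convergence, which requires a.e. convergence along a subsequence.
  obtain ⟨ns, hns, hae⟩ := (tendstoInMeasure_of_tendsto_eLpNorm (by norm_num)
    (fun n ↦ (hφ₀ n).continuous.aestronglyMeasurable) hu.isH1.memLp.1
    hφ₀u).exists_seq_tendsto_ae
  have hφu := hφ₀u.comp hns.tendsto_atTop
  have hφDu := hφ₀Du.comp hns.tendsto_atTop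
  have hφτ := hφ₀τ.comp hns.tendsto_atTop
  have hφ : ∀ n, ContDiff ℝ ∞ (φ₀ (ns n)) := fun n ↦ hφ₀ (ns n)
  have hGφ : ∀ n, ContDiff ℝ ∞ fun x ↦ G (φ₀ (ns n) x) := fun n ↦ hG.comp (hφ n)
  have hmeas : AEStronglyMeasurable (fun x ↦ deriv G (u x)) (interiorMeasure U) :=
    hG'.comp_aestronglyMeasurable hu.isH1.memLp.1
  have hmemD : MemLp (fun x ↦ deriv G (u x) • Du x) 2 (interiorMeasure U) :=
    hu.isH1.memLp_gradient.of_le_mul (hmeas.smul hu.isH1.memLp_gradient.1)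
      (.of_forall fun x ↦ by
        rw [norm_smul]
        exact mul_le_mul_of_nonneg_right (hK _) (norm_nonneg _))
  have hconv := hL.tendsto_eLpNorm_comp_sub hφu
  have hconvD : Tendsto (fun n ↦ eLpNorm (fun x ↦ gradient (fun y ↦ G (φ₀ (ns n) y)) x
      - deriv G (u x) • Du x) 2 (interiorMeasure U)) atTop (𝓝 0) := by
    have h1 := tendsto_eLpNorm_two_sub_smul (a := fun n x ↦ deriv G (φ₀ (ns n) x))
      (fun n ↦ (hG'.comp (hφ n).continuous).aestronglyMeasurable) hmeas (fun n x ↦ hK _)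
      (fun x ↦ hK _) hu.isH1.memLp_gradient
      (by filter_upwards [hae] with x hx using (hG'.tendsto _).comp hx)
    have h2 : Tendsto (fun n ↦ (K : ENNReal) * eLpNorm (fun x ↦ gradient (φ₀ (ns n)) x - Du x) 2
        (interiorMeasure U)) atTop (𝓝 0) := by
      simpa using ENNReal.Tendsto.const_mul hφDu (Or.inr ENNReal.coe_ne_top)
    refine tendsto_of_tendsto_of_tendsto_of_le_of_le tendsto_const_nhds
      (by simpa using h2.add h1) (fun _ ↦ zero_le) fun n ↦ ?_
    -- The first summand is at most `K` times the gradient error; the second is the dominated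
    -- convergence term `h1`.
    have hsplit : (fun x ↦ gradient (fun y ↦ G (φ₀ (ns n) y)) x - deriv G (u x) • Du x)
        = (fun x ↦ deriv G (φ₀ (ns n) x) • (gradient (φ₀ (ns n)) x - Du x))
          + fun x ↦ (deriv G (φ₀ (ns n) x) - deriv G (u x)) • Du x := by
      ext1 x
      rw [gradient_comp_real (hG.differentiable (by simp) _) ((hφ n).differentiable (by simp) _)]
      simp only [Pi.add_apply, smul_sub, sub_smul]
      abel
    have hm : AEStronglyMeasurable (fun x ↦ deriv G (φ₀ (ns n) x)) (interiorMeasure U) :=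
      (hG'.comp (hφ n).continuous).aestronglyMeasurable
    have hmg : AEStronglyMeasurable (gradient (φ₀ (ns n))) (interiorMeasure U) :=
      (contDiff_top_continuous_gradient (hφ n)).aestronglyMeasurable
    rw [hsplit]
    refine (eLpNorm_add_le (hm.smul (hmg.sub hu.isH1.memLp_gradient.1))
      ((hm.sub hmeas).smul hu.isH1.memLp_gradient.1) (by norm_num)).trans
      (add_le_add_left (eLpNorm_le_nnreal_smul_eLpNorm_of_ae_le_mul (.of_forall fun x ↦ ?_) 2) _)
    rw [Pi.smul_apply', nnnorm_smul]
    exact mul_le_mul_of_nonneg_right (hK _) zero_le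
  exact ⟨.of_tendsto hU hb (hL.comp_memLp_of_isFiniteMeasure hu.isH1.memLp) hmemD hGφ hconv hconvD,
    hL.comp_memLp_of_isFiniteMeasure hu.memLp_trace,
    _, hGφ, hconv, hconvD, hL.tendsto_eLpNorm_comp_sub hφτ⟩

/-! ### The truncation function. -/

/-- The derivative is continuous and vanishes outside the compact interval `[0, 1]`, so it is
bounded. -/
lemma Real.exists_lipschitzWith_smoothTransition :
    ∃ K : NNReal, LipschitzWith K Real.smoothTransition := by
  have hsm : ContDiff ℝ 1 Real.smoothTransition := Real.smoothTransition.contDiff (n := 1)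
  obtain ⟨C, hC⟩ := (isCompact_Icc (a := (0 : ℝ)) (b := 1)).exists_bound_of_continuousOn
    (hsm.continuous_deriv le_rfl).continuousOn
  have hC0 : 0 ≤ C := (norm_nonneg _).trans (hC 0 (by simp))
  refine ⟨C.toNNReal, lipschitzWith_of_nnnorm_deriv_le (hsm.differentiable (by simp)) fun x ↦ ?_⟩
  rw [← NNReal.coe_le_coe, coe_nnnorm, Real.coe_toNNReal C hC0]
  rcases lt_or_ge x 0 with hx | hx
  · have : Real.smoothTransition =ᶠ[𝓝 x] fun _ ↦ 0 := by
      filter_upwards [Iio_mem_nhds hx] with y hy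
      exact Real.smoothTransition.zero_of_nonpos (le_of_lt hy)
    simpa [this.deriv_eq] using hC0
  rcases lt_or_ge 1 x with hx1 | hx1
  · have : Real.smoothTransition =ᶠ[𝓝 x] fun _ ↦ 1 := by
      filter_upwards [Ioi_mem_nhds hx1] with y hy
      exact Real.smoothTransition.one_of_one_le (le_of_lt hy)
    simpa [this.deriv_eq] using hC0
  exact hC x ⟨hx, hx1⟩

/-- A smooth substitute for the truncation `t ↦ - max (c - t) 0`. -/
lemma exists_smooth_truncation (c : ℝ) : ∃ (G : ℝ → ℝ) (K : NNReal), ContDiff ℝ ∞ G ∧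
    LipschitzWith K G ∧ (∀ t, 0 ≤ deriv G t) ∧ (∀ t, c ≤ t → G t = 0) ∧ ∀ t, t < c → G t < 0 := by
  obtain ⟨K, hK⟩ := Real.exists_lipschitzWith_smoothTransition
  refine ⟨fun t ↦ - Real.smoothTransition (c - t), K, ?_, ?_, fun t ↦ Monotone.deriv_nonneg ?_,
    fun t ht ↦ ?_, fun t ht ↦ ?_⟩
  · exact (Real.smoothTransition.contDiff.comp (contDiff_const.sub contDiff_id)).neg
  · refine LipschitzWith.of_dist_le_mul fun s t ↦ ?_
    rw [dist_neg_neg, ← dist_sub_left c s t]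
    exact hK.dist_le_mul _ _
  · exact fun s t hst ↦ neg_le_neg (Real.smoothTransition.monotone (by linarith))
  · simp [Real.smoothTransition.zero_of_nonpos (sub_nonpos.2 ht)]
  · simpa using Real.smoothTransition.pos_of_pos (sub_pos.2 ht)

/-! ### The comparison argument. -/

lemma MeasureTheory.MemLp.integral_sub_const_mul {X : Type*} [MeasurableSpace X] {μ : Measure X}
    [IsFiniteMeasure μ] {a b : X → ℝ} (ha : MemLp a 2 μ) (hb : MemLp b 2 μ) (k : ℝ) :
    ∫ x, (a x - k) * b x ∂μ = (∫ x, a x * b x ∂μ) - k * ∫ x, b x ∂μ := by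
  have h1 : Integrable (fun x ↦ a x * b x) μ := ha.integrable_mul hb
  have h2 : Integrable (fun x ↦ k * b x) μ := (hb.integrable (by norm_num)).const_mul k
  rw [← integral_const_mul, ← integral_sub h1 h2]
  simp only [sub_mul]

/-- Comparison principle: constant subsolutions are below the solution. -/
lemma IsRobinSolution.const_le {d : ℕ} (hd : 1 ≤ d) {U : Set (EuclideanSpace ℝ (Fin d))}
    (hU : IsBoundedLipschitzDomain U) {α : ℝ} (hα : 0 ≤ α)
    {f g u : EuclideanSpace ℝ (Fin d) → ℝ} (hf : MemLp f 2 (interiorMeasure U))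
    (hg : MemLp g 2 (surfaceMeasure U)) (hu : IsRobinSolution U α f g u) {c : ℝ}
    (hfc : ∀ᵐ x ∂(interiorMeasure U), c ≤ f x)
    (hgc : ∀ᵐ x ∂(surfaceMeasure U), α * c ≤ g x) :
    ∀ᵐ x ∂(interiorMeasure U), c ≤ u x := by
  have := isFiniteMeasure_surfaceMeasure hd hU
  have : IsFiniteMeasure (interiorMeasure U) :=
    isFiniteMeasure_restrict.2 hU.isBounded.measure_lt_top.ne
  obtain ⟨G, K, hG, hL, hG', hG0, hGneg⟩ := exists_smooth_truncation c
  have hGnonpos : ∀ t, G t ≤ 0 := fun t ↦ (lt_or_ge t c).elim (fun h ↦ (hGneg t h).le)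
    fun h ↦ (hG0 t h).le
  have hGmul : ∀ t, 0 ≤ (t - c) * G t := fun t ↦ (lt_or_ge t c).elim
    (fun h ↦ mul_nonneg_of_nonpos_of_nonpos (by linarith) (hGnonpos t))
    fun h ↦ by rw [hG0 t h, mul_zero]
  obtain ⟨Du, τ, htr, hweak⟩ := hu
  have hv := htr.comp hU.isOpen hU.isBounded hG hL
  have key := hweak _ _ _ hv
  have hGu := hv.isH1.memLp
  have hGτ := hv.memLp_trace
  have hgrad : 0 ≤ ∫ x, inner ℝ (Du x) (deriv G (u x) • Du x) ∂(interiorMeasure U) :=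
    integral_nonneg fun x ↦ by
      rw [inner_smul_right]
      exact mul_nonneg (hG' _) real_inner_self_nonneg
  have hint : Integrable (fun x ↦ (u x - c) * G (u x)) (interiorMeasure U) :=
    (htr.isH1.memLp.sub (memLp_const c)).integrable_mul hGu
  -- The constant `c` solves the problem with data `c` and `α * c`, so the corrections in `e1`, `e2`
  -- cancel each other, as do those in `e3` (times `α`) and `e4`.
  have e1 := htr.isH1.memLp.integral_sub_const_mul hGu c
  have e2 := hf.integral_sub_const_mul hGu c
  have e3 := htr.memLp_trace.integral_sub_const_mul hGτ c
  have e4 := hg.integral_sub_const_mul hGτ (α * c)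
  have i1 : 0 ≤ ∫ x, (u x - c) * G (u x) ∂(interiorMeasure U) :=
    integral_nonneg fun x ↦ hGmul _
  have i2 : ∫ x, (f x - c) * G (u x) ∂(interiorMeasure U) ≤ 0 := by
    refine integral_nonpos_of_ae ?_
    filter_upwards [hfc] with x hx
    exact mul_nonpos_of_nonneg_of_nonpos (sub_nonneg.2 hx) (hGnonpos _)
  have i3 : 0 ≤ α * ∫ x, (τ x - c) * G (τ x) ∂(surfaceMeasure U) :=
    mul_nonneg hα (integral_nonneg fun x ↦ hGmul _)
  have i4 : ∫ x, (g x - α * c) * G (τ x) ∂(surfaceMeasure U) ≤ 0 := by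
    refine integral_nonpos_of_ae ?_
    filter_upwards [hgc] with x hx
    exact mul_nonpos_of_nonneg_of_nonpos (sub_nonneg.2 hx) (hGnonpos _)
  rw [e3, mul_sub] at i3
  have hzero : ∫ x, (u x - c) * G (u x) ∂(interiorMeasure U) = 0 := by
    refine le_antisymm ?_ i1
    linarith
  have hae := (integral_eq_zero_iff_of_nonneg (fun x ↦ hGmul (u x)) hint).1 hzero
  filter_upwards [hae] with x hx
  by_contra! hlt
  exact (mul_pos_of_neg_of_neg (sub_neg.2 hlt) (hGneg _ hlt)).ne' hx

theorem mainTheorem8 {d : ℕ} (hd : 1 ≤ d) (U : Set (EuclideanSpace ℝ (Fin d)))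
    (hU : IsBoundedLipschitzDomain U) (α : ℝ) (hα : 0 ≤ α)
    (f : EuclideanSpace ℝ (Fin d) → ℝ) (hf : MemLp f 2 (interiorMeasure U))
    (g : EuclideanSpace ℝ (Fin d) → ℝ) (hg : MemHHalfBoundary U g)
    (u : EuclideanSpace ℝ (Fin d) → ℝ) (hu : IsRobinSolution U α f g u) :
    ((∀ᵐ x ∂(interiorMeasure U), 0 ≤ f x) → (∀ᵐ x ∂(surfaceMeasure U), 0 ≤ g x) →
      ∀ᵐ x ∂(interiorMeasure U), 0 ≤ u x) ∧
    (∀ c : ℝ, 0 < c →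
      (∀ᵐ x ∂(interiorMeasure U), c ≤ f x) → (∀ᵐ x ∂(surfaceMeasure U), α * c ≤ g x) →
      ∀ᵐ x ∂(interiorMeasure U), c ≤ u x) := by
  refine ⟨fun hf0 hg0 ↦ hu.const_le hd hU hα hf hg.memLp hf0 (by simpa using hg0),
    fun c _ hfc hgc ↦ hu.const_le hd hU hα hf hg.memLp hfc hgc⟩
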